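/- Let $(\Omega,\Sigma,\mu)$ be a nonatomic probability space (every measurable set of positive measure has a measurable subset of strictly smaller positive measure), let $L_1=L_1(\Omega,\Sigma,\mu)$ be the real $L_1$-space, and let $X$ be a real Banach space with a (finite or countably infinite) unconditional basis. For a measurable set $A$ with $\mu(A)>0$, a *sign supported on* $A$ is a function $\chi_{B_1}-\chi_{B_2}$, where $B_1,B_2$ form a partition of $A$ into two measurable sets of equal measure. A bounded linear operator $T\colon L_1\to X$ is *PP-narrow* if for every measurable $A$ with $\mu(A)>0$ and every $\varepsilon>0$ there is a sign $f$ supported on $A$ with $\|Tf\|\le\varepsilon$. It is *hereditarily PP-narrow* (*HPP-narrow*) if for every measurable $A$ with $\mu(A)>0$ and every sub-$\sigma$-algebra $\Sigma_1\subset\Sigma$ on $A$ such that $(A,\Sigma_1,\mu)$ is nonatomic, the restriction of $T$ to $L_1(A,\Sigma_1,\mu)$ is PP-narrow; that is, for every $B\in\Sigma_1$ with $\mu(B)>0$ and every $\varepsilon>0$ there is a $\Sigma_1$-measurable sign $f$ supported on $B$ with $\|Tf\|\le\varepsilon$ (functions on $A$ are extended by $0$ to $\Omega$). A bounded linear operator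 $T\colon L_1\to X$ is a *sign-embedding* if there is $\delta>0$ such that $\|Tf\|\ge\delta\|f\|$ for every sign $f$ supported on some measurable set of positive measure. Then every bounded linear operator $T\colon L_1\to X$ is HPP-narrow, and in particular PP-narrow. Consequently, there is no sign-embedding of $L_1$ into $X$. -/

import Mathlib

open MeasureTheory

/-- A measure is nonatomic if every measurable set of positive measure has a measurable subset of
strictly smaller positive measure. (Mathlib's `NoAtoms` only says that points are null sets.) -/
def IsNonatomic {α : Type*} {m : MeasurableSpace α} (ν : Measure α) : Prop :=
  ∀ B : Set α, MeasurableSet B → 0 < ν B →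
    ∃ C : Set α, C ⊆ B ∧ MeasurableSet C ∧ 0 < ν C ∧ ν C < ν B

/-- `f` is a sign supported on `A`: `f = χ_{B₁} - χ_{B₂}`, where `B₁`, `B₂` form a partition of `A`
into two measurable sets of equal measure. -/
def IsSign {α : Type*} {m : MeasurableSpace α} (ν : Measure α) (A : Set α) (f : α → ℝ) : Prop :=
  ∃ B₁ B₂ : Set α, MeasurableSet B₁ ∧ MeasurableSet B₂ ∧ Disjoint B₁ B₂ ∧ B₁ ∪ B₂ = A ∧
    ν B₁ = ν B₂ ∧ f = fun x => B₁.indicator (fun _ => (1 : ℝ)) x - B₂.indicator (fun _ => (1 : ℝ)) x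

section

variable {Ω : Type*} [MeasurableSpace Ω] {μ : Measure Ω}
  {X : Type*} [NormedAddCommGroup X] [NormedSpace ℝ X]

/-- `T : L₁(μ) → X` is PP-narrow: for every measurable `A` of positive measure and every `ε > 0`
there is a sign supported on `A` whose class `f` in `L₁(μ)` satisfies `‖T f‖ ≤ ε`. -/
def PPNarrow (T : Lp ℝ 1 μ →L[ℝ] X) : Prop :=
  ∀ A : Set Ω, MeasurableSet A → 0 < μ A → ∀ ε : ℝ, 0 < ε →
    ∃ g : Ω → ℝ, IsSign μ A g ∧ ∃ f : Lp ℝ 1 μ, f =ᵐ[μ] g ∧ ‖T f‖ ≤ ε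

/-- The restriction of the measure `μ` to a sub-`σ`-algebra `m₁` on the subset `A`; for measurable
`A` it maps `B ∈ m₁` to `μ B`. -/
noncomputable def subMeasure (μ : Measure Ω) (A : Set Ω) (m₁ : MeasurableSpace A)
    (hm : m₁ ≤ Subtype.instMeasurableSpace) : @Measure A m₁ :=
  (@Measure.comap A Ω Subtype.instMeasurableSpace _ Subtype.val μ).trim hm

/-- The restriction of `T` to `L₁(A, m₁, μ)` is PP-narrow. Here a function on `A` is regarded as a
function on `Ω` by extending it by zero, which makes `L₁(A, m₁, μ)` a subspace of `L₁(μ)`. -/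
def PPNarrowOn (T : Lp ℝ 1 μ →L[ℝ] X) (A : Set Ω) (m₁ : MeasurableSpace A)
    (hm : m₁ ≤ Subtype.instMeasurableSpace) : Prop :=
  ∀ B : Set A, MeasurableSet[m₁] B → 0 < subMeasure μ A m₁ hm B → ∀ ε : ℝ, 0 < ε →
    ∃ g : A → ℝ, IsSign (subMeasure μ A m₁ hm) B g ∧
      ∃ f : Lp ℝ 1 μ, f =ᵐ[μ] Function.extend Subtype.val g 0 ∧ ‖T f‖ ≤ ε

/-- `T : L₁(μ) → X` is hereditarily PP-narrow: for every measurable `A` of positive measure and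
every sub-`σ`-algebra `m₁` on `A` on which `μ` is nonatomic, the restriction of `T` to
`L₁(A, m₁, μ)` is PP-narrow. -/
def HPPNarrow (T : Lp ℝ 1 μ →L[ℝ] X) : Prop :=
  ∀ A : Set Ω, MeasurableSet A → 0 < μ A →
    ∀ (m₁ : MeasurableSpace A) (hm : m₁ ≤ Subtype.instMeasurableSpace),
      IsNonatomic (subMeasure μ A m₁ hm) → PPNarrowOn T A m₁ hm

/-- `T : L₁(μ) → X` is a sign-embedding: it is bounded below on the signs. (No injectivity is
required, and only the mean-zero `{-1,0,1}`-valued functions count as signs, so that this is the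
weakest of the usual variants.) -/
def IsSignEmbedding (T : Lp ℝ 1 μ →L[ℝ] X) : Prop :=
  ∃ δ : ℝ, 0 < δ ∧ ∀ A : Set Ω, MeasurableSet A → 0 < μ A →
    ∀ g : Ω → ℝ, IsSign μ A g → ∀ f : Lp ℝ 1 μ, f =ᵐ[μ] g → δ * ‖f‖ ≤ ‖T f‖

end

/-!
For a functional `x` on `X`, the bounded function representing `x ∘ T` has a Haar expansion along
any dyadic tree of measurable sets. If the Haar functions of the tree are chosen so that their
images under `T` along each path are almost disjoint blocks of the unconditional basis, then the
signs of the coefficients along a path can be changed at the cost of a constant. Testing on the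
Riesz product `χ_L / ν L - χ_A / ν A` of a leaf `L`, whose `L₁`-norm is at most `2`, one finds that
the absolute values of the terms of the expansion have a bounded sum at every leaf. Consequently a
function on `A` whose Haar coefficients are all at most `1 / M` in absolute value has an image of
norm `O(1 / M)`. Random walks with steps `±1 / M` stopped at `±1` provide such functions that are
signs up to a set of small measure (`exists_isTrisection_walk`, `exists_isHalving_norm_sub_le`).

The tree is built from two facts about nonatomic measures: Sierpiński's theorem
(`IsNonatomic.exists_subset_measureReal_eq`) and the existence of signs that almost annihilate
finitely many functionals (`exists_isHalving_norm_proj_le`). The blocks are controlled by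
`exists_finset_abs_add_le`. Only the set function `B ↦ T χ_B` enters the argument, and this makes
it apply at once to sub-`σ`-algebras on subsets.
-/

/-! ### Nonatomic measures take every intermediate value -/

section Nonatomic

variable {α : Type*} {m : MeasurableSpace α} {ν : Measure α} [IsFiniteMeasure ν]

theorem IsNonatomic.exists_subset_measureReal_le (hν : IsNonatomic ν) {B : Set α}
    (hB : MeasurableSet B) (hpos : 0 < ν.real B) {ε : ℝ} (hε : 0 < ε) :
    ∃ C ⊆ B, MeasurableSet C ∧ 0 < ν.real C ∧ ν.real C ≤ ε := by
  have key : ∀ n : ℕ, ∃ C ⊆ B, MeasurableSet C ∧ 0 < ν.real C ∧ ν.real C ≤ ν.real B / 2 ^ n := by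
    intro n
    induction n with
    | zero => exact ⟨B, subset_rfl, hB, hpos, by simp⟩
    | succ n ih =>
      obtain ⟨C, hCB, hC, hCpos, hCle⟩ := ih
      obtain ⟨D, hDC, hD, hDpos, hDlt⟩ := hν C hC (ENNReal.toReal_pos_iff.1 hCpos).1
      have h1 : 0 < ν.real D := ENNReal.toReal_pos hDpos.ne' (measure_ne_top _ _)
      have h2 : ν.real D < ν.real C :=
        (ENNReal.toReal_lt_toReal (measure_ne_top _ _) (measure_ne_top _ _)).2 hDlt
      have h3 : ν.real (C \ D) = ν.real C - ν.real D := measureReal_sdiff hDC hD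
      have h4 : ν.real B / 2 ^ (n + 1) = ν.real B / 2 ^ n / 2 := by rw [pow_succ]; field_simp
      rw [h4]
      rcases le_total (ν.real D) (ν.real C / 2) with h | h
      · exact ⟨D, hDC.trans hCB, hD, h1, by linarith⟩
      · exact ⟨C \ D, Set.sdiff_subset.trans hCB, hC.diff hD, by linarith, by linarith⟩
  obtain ⟨n, hn⟩ := exists_pow_lt_of_lt_one (div_pos hε hpos) (by norm_num : (1 / 2 : ℝ) < 1)
  obtain ⟨C, hCB, hC, hCpos, hCle⟩ := key n
  refine ⟨C, hCB, hC, hCpos, hCle.trans ?_⟩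
  rw [lt_div_iff₀ hpos] at hn
  calc ν.real B / 2 ^ n = (1 / 2) ^ n * ν.real B := by rw [one_div, inv_pow]; field_simp
    _ ≤ ε := hn.le

/-- **Sierpiński's theorem**: a finite nonatomic measure takes every value between `0` and `ν A` on
the measurable subsets of `A`. -/
theorem IsNonatomic.exists_subset_measureReal_eq (hν : IsNonatomic ν) {A : Set α}
    (hA : MeasurableSet A) {c : ℝ} (hc0 : 0 ≤ c) (hcA : c ≤ ν.real A) :
    ∃ B ⊆ A, MeasurableSet B ∧ ν.real B = c := by
  let Good : Set α → Prop := fun B => MeasurableSet B ∧ B ⊆ A ∧ ν.real B ≤ c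
  -- Greedy step: enlarge `B` by at least half of the possible gain.
  have step : ∀ B : {B // Good B}, ∃ D : {B // Good B}, B.1 ⊆ D.1 ∧
      ∀ E, Good E → B.1 ⊆ E → ν.real E - ν.real B.1 ≤ 2 * (ν.real D.1 - ν.real B.1) := by
    intro B
    let S : Set ℝ := {x | ∃ E, Good E ∧ B.1 ⊆ E ∧ ν.real E - ν.real B.1 = x}
    have hbdd : BddAbove S := ⟨c, by
      rintro x ⟨E, hE, -, rfl⟩
      have := hE.2.2
      have := measureReal_nonneg (μ := ν) (s := B.1)
      linarith⟩
    have h0 : (0 : ℝ) ∈ S := ⟨B.1, B.2, subset_rfl, sub_self _⟩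
    rcases (le_csSup hbdd h0).eq_or_lt with h | h
    · refine ⟨B, subset_rfl, fun E hE hBE => ?_⟩
      have := le_csSup hbdd (show ν.real E - ν.real B.1 ∈ S from ⟨E, hE, hBE, rfl⟩)
      linarith
    · obtain ⟨x, ⟨D, hD, hBD, rfl⟩, hx⟩ := exists_lt_of_lt_csSup ⟨_, h0⟩ (half_lt_self h)
      refine ⟨⟨D, hD⟩, hBD, fun E hE hBE => ?_⟩
      have := le_csSup hbdd (show ν.real E - ν.real B.1 ∈ S from ⟨E, hE, hBE, rfl⟩)
      simp only
      linarith
  choose next hsub hgain using step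
  let seq : ℕ → {B // Good B} := fun n =>
    Nat.rec ⟨∅, MeasurableSet.empty, Set.empty_subset _, by simpa using hc0⟩ (fun _ B => next B) n
  have hmono : Monotone fun n => (seq n).1 := monotone_nat_of_le_succ fun n => hsub (seq n)
  have hlim : Filter.Tendsto (fun n => ν.real (seq n).1) Filter.atTop
      (nhds (ν.real (⋃ n, (seq n).1))) :=
    (ENNReal.tendsto_toReal (measure_ne_top _ _)).comp (tendsto_measure_iUnion_atTop hmono)
  have hU : Good (⋃ n, (seq n).1) :=
    ⟨MeasurableSet.iUnion fun n => (seq n).2.1, Set.iUnion_subset fun n => (seq n).2.2.1,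
      le_of_tendsto' hlim fun n => (seq n).2.2.2⟩
  refine ⟨_, hU.2.1, hU.1, ?_⟩
  by_contra hne
  have hlt : ν.real (⋃ n, (seq n).1) < c := lt_of_le_of_ne hU.2.2 hne
  have hd : ν.real (A \ ⋃ n, (seq n).1) = ν.real A - ν.real (⋃ n, (seq n).1) :=
    measureReal_sdiff hU.2.1 hU.1
  obtain ⟨C, hCs, hC, hCpos, hCle⟩ := hν.exists_subset_measureReal_le (hA.diff hU.1)
    (by linarith) (sub_pos.2 hlt)
  have hdisj : Disjoint (⋃ n, (seq n).1) C :=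
    (Set.disjoint_sdiff_left.mono_left hCs).symm
  have hE : ν.real ((⋃ n, (seq n).1) ∪ C) = ν.real (⋃ n, (seq n).1) + ν.real C :=
    measureReal_union hdisj hC
  have hEgood : Good ((⋃ n, (seq n).1) ∪ C) :=
    ⟨hU.1.union hC, Set.union_subset hU.2.1 (hCs.trans Set.sdiff_subset), by linarith⟩
  have hle : ∀ n, ν.real C ≤ 2 * (ν.real (seq (n + 1)).1 - ν.real (seq n).1) := by
    intro n
    have h1 := hgain (seq n) _ hEgood ((Set.subset_iUnion (fun n => (seq n).1) n).trans
      Set.subset_union_left)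
    have h2 : ν.real (seq n).1 ≤ ν.real (⋃ n, (seq n).1) :=
      measureReal_mono (Set.subset_iUnion (fun n => (seq n).1) n)
    change _ ≤ 2 * (ν.real (next (seq n)).1 - ν.real (seq n).1)
    linarith
  have hlim' : Filter.Tendsto (fun n => 2 * (ν.real (seq (n + 1)).1 - ν.real (seq n).1))
      Filter.atTop (nhds 0) := by
    simpa using ((hlim.comp (Filter.tendsto_add_atTop_nat 1)).sub hlim).const_mul 2
  exact absurd (ge_of_tendsto' hlim' hle) (not_le.2 hCpos)

/-- `(P, N)` is a partition of `A` into two measurable sets of equal measure, so that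
`χ_P - χ_N` is a sign supported on `A`. -/
structure IsHalving (ν : Measure α) (A P N : Set α) : Prop where
  measurableSet_left : MeasurableSet P
  measurableSet_right : MeasurableSet N
  disjoint : Disjoint P N
  union_eq : P ∪ N = A
  measureReal_left : ν.real P = ν.real A / 2
  measureReal_right : ν.real N = ν.real A / 2

omit [IsFiniteMeasure ν] in
theorem IsHalving.symm {A P N : Set α} (h : IsHalving ν A P N) : IsHalving ν A N P :=
  ⟨h.2, h.1, h.3.symm, by rw [Set.union_comm, h.4], h.6, h.5⟩

theorem IsHalving.union {A A' P P' N N' : Set α} (h : IsHalving ν A P N)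
    (h' : IsHalving ν A' P' N') (hd : Disjoint A A') :
    IsHalving ν (A ∪ A') (P ∪ P') (N ∪ N') := by
  have hd' := hd
  rw [← h.union_eq, ← h'.union_eq, Set.disjoint_union_left, Set.disjoint_union_right,
    Set.disjoint_union_right] at hd'
  obtain ⟨⟨h1, h2⟩, h3, h4⟩ := hd'
  have hA' : MeasurableSet A' := h'.union_eq ▸ h'.1.union h'.2
  refine ⟨h.1.union h'.1, h.2.union h'.2, ?_, ?_, ?_, ?_⟩
  · simp only [Set.disjoint_union_left, Set.disjoint_union_right]
    exact ⟨⟨h.3, h3.symm⟩, h2, h'.3⟩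
  · rw [Set.union_union_union_comm, h.4, h'.4]
  · rw [measureReal_union h1 h'.1, measureReal_union hd hA', h.5, h'.5]; ring
  · rw [measureReal_union h4 h'.2, measureReal_union hd hA', h.6, h'.6]; ring

theorem IsNonatomic.exists_isHalving (hν : IsNonatomic ν) {A : Set α} (hA : MeasurableSet A) :
    ∃ P N, IsHalving ν A P N := by
  have h0 := measureReal_nonneg (μ := ν) (s := A)
  obtain ⟨P, hPA, hP, h⟩ := hν.exists_subset_measureReal_eq hA (c := ν.real A / 2)
    (by linarith) (by linarith)
  refine ⟨P, A \ P, hP, hA.diff hP, Set.disjoint_sdiff_right, Set.union_sdiff_cancel hPA, h, ?_⟩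
  rw [measureReal_sdiff hPA hP, h]; ring

/-! ### Signs that almost annihilate finitely many functionals -/

/-- A finitely additive vector-valued set function on the measurable sets whose variation is
dominated by `K` times `ν`. Such set functions are the maps `B ↦ T χ_B` for `T` a bounded operator
on `L₁(ν)` with `‖T‖ ≤ K`. -/
structure IsDominated {X : Type*} [NormedAddCommGroup X] (ν : Measure α) (K : ℝ)
    (τ : Set α → X) : Prop where
  union : ∀ P N, MeasurableSet P → MeasurableSet N → Disjoint P N → τ (P ∪ N) = τ P + τ N
  norm_le : ∀ B, MeasurableSet B → ‖τ B‖ ≤ K * ν.real B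

omit [IsFiniteMeasure ν] in
theorem IsDominated.empty {X : Type*} [NormedAddCommGroup X] {K : ℝ} {τ : Set α → X}
    (hτ : IsDominated ν K τ) : τ ∅ = 0 := by
  simpa using hτ.norm_le ∅ MeasurableSet.empty

omit [IsFiniteMeasure ν] in
theorem IsDominated.comp {X Y : Type*} [NormedAddCommGroup X] [NormedSpace ℝ X]
    [NormedAddCommGroup Y] [NormedSpace ℝ Y] {K : ℝ} {τ : Set α → X} (h : IsDominated ν K τ)
    (f : X →L[ℝ] Y) : IsDominated ν (‖f‖ * K) fun B => f (τ B) where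
  union P N hP hN hd := by rw [h.union P N hP hN hd, map_add]
  norm_le B hB := (f.le_opNorm _).trans <| by
    rw [mul_assoc]; exact mul_le_mul_of_nonneg_left (h.norm_le B hB) (norm_nonneg _)

/-- Choosing between the halvings of `A₁ ∪ A₂` obtained from halvings of `A₁` and `A₂` by
matching them in the two possible ways, one keeps the sum of squares at most additive, whereas the
trivial bound is quadratic in the measure. Repeated bisection thus gains a factor `2` each time. -/
theorem exists_isHalving_sum_sq_le (hν : IsNonatomic ν) {ι : Type*} (F : Finset ι)
    (φ : ι → Set α → ℝ) (K : ι → ℝ) (hφ : ∀ i, IsDominated ν (K i) (φ i)) (k : ℕ) {A : Set α}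
    (hA : MeasurableSet A) :
    ∃ P N, IsHalving ν A P N ∧
      ∑ i ∈ F, (φ i P - φ i N) ^ 2 ≤ (∑ i ∈ F, K i ^ 2) * ν.real A ^ 2 / 2 ^ k := by
  induction k generalizing A with
  | zero =>
    obtain ⟨P, N, h⟩ := hν.exists_isHalving hA
    refine ⟨P, N, h, ?_⟩
    rw [pow_zero, div_one, Finset.sum_mul]
    refine Finset.sum_le_sum fun i _ => ?_
    have h1 := (hφ i).norm_le P h.1
    have h2 := (hφ i).norm_le N h.2
    rw [h.5, Real.norm_eq_abs] at h1
    rw [h.6, Real.norm_eq_abs] at h2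
    rw [← mul_pow, ← sq_abs]
    exact pow_le_pow_left₀ (abs_nonneg _) ((abs_sub _ _).trans (by linarith)) 2
  | succ k ih =>
    obtain ⟨A₁, A₂, h⟩ := hν.exists_isHalving hA
    obtain ⟨P₁, N₁, h₁, hs₁⟩ := ih h.1
    obtain ⟨P₂, N₂, h₂, hs₂⟩ := ih h.2
    rw [h.5] at hs₁
    rw [h.6] at hs₂
    have hadd : ∀ P N, IsHalving ν A₂ P N → ∀ i,
        φ i (P₁ ∪ P) - φ i (N₁ ∪ N) = (φ i P₁ - φ i N₁) + (φ i P - φ i N) := by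
      intro P N hPN i
      have hd := h.disjoint
      rw [← h₁.union_eq, ← hPN.union_eq, Set.disjoint_union_left, Set.disjoint_union_right,
        Set.disjoint_union_right] at hd
      rw [(hφ i).union _ _ h₁.1 hPN.1 hd.1.1, (hφ i).union _ _ h₁.2 hPN.2 hd.2.2]
      ring
    have hsum : ∑ i ∈ F, (φ i (P₁ ∪ P₂) - φ i (N₁ ∪ N₂)) ^ 2 +
        ∑ i ∈ F, (φ i (P₁ ∪ N₂) - φ i (N₁ ∪ P₂)) ^ 2 =
        2 * ∑ i ∈ F, (φ i P₁ - φ i N₁) ^ 2 + 2 * ∑ i ∈ F, (φ i P₂ - φ i N₂) ^ 2 := by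
      rw [Finset.mul_sum, Finset.mul_sum, ← Finset.sum_add_distrib, ← Finset.sum_add_distrib]
      refine Finset.sum_congr rfl fun i _ => ?_
      rw [hadd _ _ h₂, hadd _ _ h₂.symm]; ring
    have hval : (∑ i ∈ F, K i ^ 2) * ν.real A ^ 2 / 2 ^ (k + 1) =
        2 * ((∑ i ∈ F, K i ^ 2) * (ν.real A / 2) ^ 2 / 2 ^ k) := by
      rw [pow_succ]; field_simp; ring
    rw [hval]
    rcases le_total (∑ i ∈ F, (φ i (P₁ ∪ P₂) - φ i (N₁ ∪ N₂)) ^ 2)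
      (∑ i ∈ F, (φ i (P₁ ∪ N₂) - φ i (N₁ ∪ P₂)) ^ 2) with hc | hc
    · refine ⟨P₁ ∪ P₂, N₁ ∪ N₂, ?_, by linarith⟩
      simpa only [h.union_eq] using h₁.union h₂ h.disjoint
    · refine ⟨P₁ ∪ N₂, N₁ ∪ P₂, ?_, by linarith⟩
      simpa only [h.union_eq] using h₁.union h₂.symm h.disjoint

theorem exists_isHalving_norm_proj_le (hν : IsNonatomic ν) {X β : Type*} [NormedAddCommGroup X]
    [NormedSpace ℝ X] (b : UnconditionalSchauderBasis β ℝ X) {K : ℝ} {τ : Set α → X}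
    (hτ : IsDominated ν K τ) (F : Finset β) {A : Set α} (hA : MeasurableSet A) {η : ℝ}
    (hη : 0 < η) :
    ∃ P N, IsHalving ν A P N ∧ ‖b.proj F (τ P - τ N)‖ ≤ η := by
  obtain ⟨C, hC0, hC⟩ : ∃ C : ℝ, 0 < C ∧ ∑ i ∈ F, ‖b i‖ ≤ C :=
    ⟨_, by positivity, (le_add_of_nonneg_right zero_le_one : ∑ i ∈ F, ‖b i‖ ≤ _ + 1)⟩
  set S := (∑ i ∈ F, (‖b.coord i‖ * K) ^ 2) * ν.real A ^ 2 with hS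
  have hS0 : 0 ≤ S := by positivity
  obtain ⟨k, hk⟩ := exists_pow_lt_of_lt_one (show 0 < (η / C) ^ 2 / (S + 1) by positivity)
    (by norm_num : (1 / 2 : ℝ) < 1)
  have hk' : S / 2 ^ k ≤ (η / C) ^ 2 := by
    rw [lt_div_iff₀ (by positivity), one_div, inv_pow] at hk
    have h2 : (0 : ℝ) < (2 ^ k)⁻¹ := by positivity
    rw [div_eq_inv_mul]
    nlinarith
  obtain ⟨P, N, h, hs⟩ := exists_isHalving_sum_sq_le hν F (fun i B => b.coord i (τ B)) _
    (fun i => hτ.comp (b.coord i)) k hA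
  refine ⟨P, N, h, ?_⟩
  have hi : ∀ i ∈ F, |b.coord i (τ P - τ N)| ≤ η / C := fun i hi => by
    refine abs_le_of_sq_le_sq ?_ (by positivity)
    refine le_trans ?_ (hs.trans hk')
    rw [map_sub]
    exact Finset.single_le_sum (f := fun i => (b.coord i (τ P) - b.coord i (τ N)) ^ 2)
      (fun i _ => sq_nonneg _) hi
  rw [GeneralSchauderBasis.proj_apply]
  calc ‖∑ i ∈ F, b.coord i (τ P - τ N) • b i‖ ≤ ∑ i ∈ F, η / C * ‖b i‖ := by
        refine norm_sum_le_of_le F fun i h => ?_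
        rw [norm_smul]
        exact mul_le_mul_of_nonneg_right (hi i h) (norm_nonneg _)
    _ = η / C * ∑ i ∈ F, ‖b i‖ := by rw [Finset.mul_sum]
    _ ≤ η / C * C := mul_le_mul_of_nonneg_left hC (by positivity)
    _ = η := by field_simp

end Nonatomic

/-! ### Projections along a path of the Haar tree -/

section Projections

variable {X β : Type*} [NormedAddCommGroup X] [NormedSpace ℝ X]
  (b : UnconditionalSchauderBasis β ℝ X)

/-- Adding one vector `w` with a block expansion to a sum `v` of vectors whose expansions lie beyond
that block: the coordinates of `w` live essentially on `F₁ \ F`, those of `v` essentially off `F₁`,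
so the sign of `x w` can be switched independently of the signs already chosen for `v`. -/
theorem exists_finset_abs_add_le {C : ℝ} (hC : ∀ F, ‖b.proj F‖ ≤ C) {F F₁ E E' : Finset β}
    (hF : F ⊆ F₁) (hE : Disjoint E F₁) (hE' : Disjoint E' F₁) {x : StrongDual ℝ X} (hx : ‖x‖ ≤ 1)
    {v w : X} {η : ℝ} (hv : ‖b.proj F₁ v‖ ≤ η) (hw : ‖b.proj F w‖ ≤ η)
    (hw₁ : ‖w - b.proj F₁ w‖ ≤ η) :
    ∃ G G' : Finset β, Disjoint G F ∧ Disjoint G' F ∧ ‖b.proj F (v + w)‖ ≤ 4 * (C + 1) * η ∧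
      |x w| + (x (b.proj E v - b.proj E' v) + η) ≤
        x (b.proj G (v + w) - b.proj G' (v + w)) + 4 * (C + 1) * η := by
  classical
  have hC0 : 0 ≤ C := (norm_nonneg _).trans (hC ∅)
  have hη : 0 ≤ η := (norm_nonneg _).trans hw
  have hxle : ∀ y : X, |x y| ≤ ‖y‖ := fun y =>
    (x.le_opNorm y).trans (mul_le_of_le_one_left (norm_nonneg _) hx)
  have hP : ∀ (A : Finset β) (y : X) (r : ℝ), ‖y‖ ≤ r → ‖b.proj A y‖ ≤ C * r := fun A y r hr =>
    ((b.proj A).le_opNorm y).trans (mul_le_mul (hC A) hr (norm_nonneg _) hC0)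
  have hsub : ∀ A ⊆ F₁, ‖b.proj A v‖ ≤ C * η := fun A hA => by
    have := b.proj_comp A F₁ v
    rw [Finset.inter_eq_left.2 hA] at this
    rw [← this]; exact hP _ _ _ hv
  have hoff : ∀ A, Disjoint A F₁ → ‖b.proj A w‖ ≤ C * η := fun A hA => by
    have := b.proj_comp A F₁ w
    rw [Finset.disjoint_iff_inter_eq_empty.1 hA, GeneralSchauderBasis.proj_empty,
      zero_apply] at this
    rw [← sub_zero (b.proj A w), ← this, ← map_sub]; exact hP _ _ _ hw₁
  have hunion : ∀ A B : Finset β, Disjoint A B → ∀ y, b.proj (A ∪ B) y = b.proj A y + b.proj B y :=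
    fun A B hAB y => by simp only [GeneralSchauderBasis.proj_apply, Finset.sum_union hAB]
  have hDF : Disjoint (F₁ \ F) F := Finset.sdiff_disjoint
  have hD : ∀ A, Disjoint A F₁ → Disjoint A (F₁ \ F) := fun A hA =>
    hA.mono_right Finset.sdiff_subset
  have hw₂ : b.proj (F₁ \ F) w = w - (w - b.proj F₁ w) - b.proj F w := by
    have := hunion (F₁ \ F) F hDF w
    rw [Finset.sdiff_union_of_subset hF] at this
    rw [this]; abel
  have h1 := abs_le.1 ((hxle _).trans (hoff E hE))
  have h2 := abs_le.1 ((hxle _).trans (hoff E' hE'))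
  have h3 := abs_le.1 ((hxle _).trans (hsub (F₁ \ F) Finset.sdiff_subset))
  have h4 := abs_le.1 ((hxle _).trans hw₁)
  have h5 := abs_le.1 ((hxle _).trans hw)
  have h6 : x (b.proj (F₁ \ F) w) = x w - x (w - b.proj F₁ w) - x (b.proj F w) := by
    rw [hw₂, map_sub, map_sub]
  have hnorm : ‖b.proj F (v + w)‖ ≤ 4 * (C + 1) * η := by
    rw [map_add]
    refine (norm_add_le _ _).trans ?_
    have := hsub F hF
    nlinarith
  rcases le_total 0 (x w) with hxw | hxw
  · refine ⟨E ∪ F₁ \ F, E', ?_, hE'.mono_right hF, hnorm, ?_⟩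
    · exact Finset.disjoint_union_left.2 ⟨hE.mono_right hF, hDF⟩
    · rw [hunion _ _ (hD E hE), abs_of_nonneg hxw]
      simp only [map_add, map_sub] at *
      linarith
  · refine ⟨E, E' ∪ F₁ \ F, hE.mono_right hF, ?_, hnorm, ?_⟩
    · exact Finset.disjoint_union_left.2 ⟨hE'.mono_right hF, hDF⟩
    · rw [hunion _ _ (hD E' hE'), abs_of_nonpos hxw]
      simp only [map_add, map_sub] at *
      linarith

end Projections

/-! ### The stopped random walk -/

section Walk

variable {α : Type*}

/-- `P`, `N`, `U` form a measurable partition of `A`. The function `χ_P - χ_N` approximates a sign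
on `A`; on `U` its value is still undecided. The measures of `P` and `N` may differ. -/
structure IsTrisection [MeasurableSpace α] (A P N U : Set α) : Prop where
  measurableSet_pos : MeasurableSet P
  measurableSet_neg : MeasurableSet N
  measurableSet_rest : MeasurableSet U
  disjoint_pos_neg : Disjoint P N
  disjoint_pos_rest : Disjoint P U
  disjoint_neg_rest : Disjoint N U
  union_eq : P ∪ N ∪ U = A

theorem IsTrisection.subset [MeasurableSpace α] {A P N U : Set α} (h : IsTrisection A P N U) :
    P ⊆ A ∧ N ⊆ A ∧ U ⊆ A := by
  rw [← h.union_eq]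
  exact ⟨fun _ hx => Or.inl (Or.inl hx), fun _ hx => Or.inl (Or.inr hx), fun _ hx => Or.inr hx⟩

theorem IsTrisection.union [MeasurableSpace α] {A P N U A' P' N' U' : Set α}
    (h : IsTrisection A P N U)
    (h' : IsTrisection A' P' N' U') (hd : Disjoint A A') :
    IsTrisection (A ∪ A') (P ∪ P') (N ∪ N') (U ∪ U') := by
  obtain ⟨hP, hN, hU⟩ := h.subset
  obtain ⟨hP', hN', hU'⟩ := h'.subset
  have key : ∀ {S T S' T' : Set α}, Disjoint S T → Disjoint S' T' → S ⊆ A → T ⊆ A → S' ⊆ A' →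
      T' ⊆ A' → Disjoint (S ∪ S') (T ∪ T') := fun h1 h2 hS hT hS' hT' => by
    simp only [Set.disjoint_union_left, Set.disjoint_union_right]
    exact ⟨⟨h1, (hd.mono hT hS').symm⟩, hd.mono hS hT', h2⟩
  refine ⟨h.1.union h'.1, h.2.union h'.2, h.3.union h'.3, key h.4 h'.4 hP hN hP' hN',
    key h.5 h'.5 hP hU hP' hU', key h.6 h'.6 hN hU hN' hU', ?_⟩
  rw [← h.union_eq, ← h'.union_eq]
  ext y
  simp only [Set.mem_union]
  tauto

variable {m : MeasurableSpace α} {ν : Measure α} {X β : Type*} [NormedAddCommGroup X]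
  [NormedSpace ℝ X]

/-- The value of `τ` on the function `χ_L / ν L - χ_A / ν A`. -/
noncomputable def averageDiff (ν : Measure α) (τ : Set α → X) (L A : Set α) : X :=
  (ν.real L)⁻¹ • τ L - (ν.real A)⁻¹ • τ A

theorem IsDominated.norm_averageDiff_le {K : ℝ} {τ : Set α → X} (hτ : IsDominated ν K τ)
    {L A : Set α} (hL : MeasurableSet L) (hA : MeasurableSet A) (hL0 : 0 < ν.real L)
    (hA0 : 0 < ν.real A) : ‖averageDiff ν τ L A‖ ≤ 2 * K := by
  have key : ∀ {B : Set α}, MeasurableSet B → 0 < ν.real B → ‖(ν.real B)⁻¹ • τ B‖ ≤ K := by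
    intro B hB hB0
    rw [norm_smul, Real.norm_of_nonneg (by positivity), inv_mul_le_iff₀ hB0, mul_comm]
    exact hτ.norm_le B hB
  refine (norm_sub_le _ _).trans ?_
  linarith [key hL hL0, key hA hA0]

/-- Along a step from `A` to one of its halves `P`, the normalised characteristic function changes
by the sign `χ_P - χ_N` divided by `ν A`. This is the telescoping of Riesz products. -/
theorem averageDiff_eq_add_of_isHalving {K : ℝ} {τ : Set α → X} (hτ : IsDominated ν K τ)
    {A P N : Set α} (h : IsHalving ν A P N) (L : Set α) :
    averageDiff ν τ L A = averageDiff ν τ L P + (ν.real A)⁻¹ • (τ P - τ N) := by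
  have hA : τ A = τ P + τ N := by rw [← h.4, hτ.union _ _ h.1 h.2 h.3]
  rw [averageDiff, averageDiff, hA, h.5, inv_div, div_eq_mul_inv]
  module

/-- A dyadic tree of depth `n` on `A` carries a random walk with steps `±1` that starts at `j` and
is stopped at `±M`; `P`, `N` are the sets where it has reached `M`, `-M`, and `U` is the set where
it has not stopped. Each step is a sign on a node of the tree, chosen so that along every path the
images of the steps under `τ` are close to disjoint blocks of the basis. The value of a functional
`x` on the walk minus its starting point is a sum over the nodes; writing it as an average over the
leaves, one bounds it by the sum over the path to the worst leaf `L`. All terms of that sum can be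
made positive by changing signs of coordinates in `x`, which is what `E` and `E'` do, and then the
terms telescope to the value on `averageDiff ν τ L A`. -/
theorem exists_isTrisection_walk [IsFiniteMeasure ν] (hν : IsNonatomic ν)
    (b : UnconditionalSchauderBasis β ℝ X) {C : ℝ} (hC : ∀ F, ‖b.proj F‖ ≤ C) {K : ℝ}
    {τ : Set α → X} (hτ : IsDominated ν K τ) (M : ℤ) (n : ℕ) (j : ℤ) (hj : |j| ≤ M) {A : Set α}
    (hA : MeasurableSet A) (hA0 : 0 < ν.real A) (F : Finset β) {η : ℝ} (hη : 0 < η) :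
    ∃ P N U, IsTrisection A P N U ∧ n * ν.real U ≤ (M ^ 2 - j ^ 2) * ν.real A ∧
      |M * (ν.real P - ν.real N) - j * ν.real A| ≤ M * ν.real U ∧
      ∀ x : StrongDual ℝ X, ‖x‖ ≤ 1 → ∃ L ⊆ A, MeasurableSet L ∧ 0 < ν.real L ∧
        ∃ E E' : Finset β, Disjoint E F ∧ Disjoint E' F ∧
          ‖b.proj F (averageDiff ν τ L A)‖ ≤ η ∧
          |x ((M : ℝ) • (τ P - τ N) - (j : ℝ) • τ A)| ≤ M * K * ν.real U + ν.real A *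
            (x (b.proj E (averageDiff ν τ L A) - b.proj E' (averageDiff ν τ L A)) + η) := by
  classical
  -- At a leaf the path is trivial and only the bound for the undecided part is needed.
  have leaf : ∀ {A : Set α}, MeasurableSet A → 0 < ν.real A → ∀ (F : Finset β) {η : ℝ}, 0 < η →
      ∀ (z : X) (r : ℝ), ‖z‖ ≤ r → ∀ x : StrongDual ℝ X, ‖x‖ ≤ 1 →
        ∃ L ⊆ A, MeasurableSet L ∧ 0 < ν.real L ∧ ∃ E E' : Finset β, Disjoint E F ∧ Disjoint E' F ∧
          ‖b.proj F (averageDiff ν τ L A)‖ ≤ η ∧ |x z| ≤ r + ν.real A *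
            (x (b.proj E (averageDiff ν τ L A) - b.proj E' (averageDiff ν τ L A)) + η) := by
    intro A hA hA0 F η hη z r hz x hx
    have hz' : |x z| ≤ r :=
      ((x.le_opNorm z).trans (mul_le_of_le_one_left (norm_nonneg _) hx)).trans hz
    refine ⟨A, subset_rfl, hA, hA0, ∅, ∅, Finset.disjoint_empty_left _,
      Finset.disjoint_empty_left _, ?_, ?_⟩
    · simpa [averageDiff] using hη.le
    · simp only [averageDiff, sub_self, map_zero, zero_add]
      have := mul_pos hA0 hη
      linarith
  have hM : (0 : ℝ) ≤ M := by exact_mod_cast (abs_nonneg j).trans hj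
  induction n generalizing j A F η with
  | zero =>
    have hj' : |(j : ℝ)| ≤ M := by exact_mod_cast hj
    have hj2 : (j : ℝ) ^ 2 ≤ M ^ 2 := sq_le_sq' (abs_le.1 hj').1 (abs_le.1 hj').2
    refine ⟨∅, ∅, A, ⟨.empty, .empty, hA, by simp, by simp, by simp, by simp⟩, ?_, ?_, ?_⟩
    · simpa using mul_nonneg (sub_nonneg.2 hj2) hA0.le
    · simpa [abs_mul, abs_of_pos hA0] using mul_le_mul_of_nonneg_right hj' hA0.le
    · refine leaf hA hA0 F hη _ _ ?_
      rw [sub_self, smul_zero, zero_sub, norm_neg, norm_smul, Real.norm_eq_abs, mul_assoc]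
      exact mul_le_mul hj' (hτ.norm_le A hA) (norm_nonneg _) hM
  | succ n ih =>
    rcases hj.lt_or_eq with hlt | heq
    swap
    · have hjM : (j : ℝ) ^ 2 = M ^ 2 := by
        rw [← sq_abs]
        exact_mod_cast congrArg (fun k : ℤ => k ^ (2 : ℕ)) heq
      rcases abs_choice j with hc | hc
      · have hjM' : (j : ℝ) = M := by exact_mod_cast hc ▸ heq
        refine ⟨A, ∅, ∅, ⟨hA, .empty, .empty, by simp, by simp, by simp, by simp⟩, ?_, ?_, ?_⟩
        · simp [hjM]
        · simp [hjM']
        · exact leaf hA hA0 F hη _ _ (by simp [hjM', hτ.empty])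
      · have hjM' : (j : ℝ) = -M := by
          have : j = -M := by omega
          exact_mod_cast this
        refine ⟨∅, A, ∅, ⟨.empty, hA, .empty, by simp, by simp, by simp, by simp⟩, ?_, ?_, ?_⟩
        · simp [hjM]
        · simp [hjM']
        · exact leaf hA hA0 F hη _ _ (by simp [hjM', hτ.empty])
    obtain ⟨hl, hr⟩ := abs_lt.1 hlt
    have hC0 : 0 ≤ C := (norm_nonneg _).trans (hC ∅)
    obtain ⟨η₁, hη₁, rfl⟩ : ∃ η₁ : ℝ, 0 < η₁ ∧ 4 * (C + 1) * η₁ = η :=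
      ⟨η / (4 * (C + 1)), by positivity, by field_simp⟩
    obtain ⟨Q, R, h, hQR⟩ := exists_isHalving_norm_proj_le hν b hτ F hA (mul_pos hη₁ hA0)
    obtain ⟨F₁, hF, hF₁⟩ : ∃ F₁, F ⊆ F₁ ∧
        ‖(τ Q - τ R) - b.proj F₁ (τ Q - τ R)‖ ≤ η₁ * ν.real A := by
      have h1 := b.tendsto_proj (τ Q - τ R)
      rw [SummationFilter.unconditional_filter] at h1
      have h2 := (Metric.tendsto_nhds.1 h1 _ (mul_pos hη₁ hA0)).and (Filter.eventually_ge_atTop F)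
      obtain ⟨F₁, h3, h4⟩ := h2.exists
      refine ⟨F₁, h4, ?_⟩
      rw [dist_comm, dist_eq_norm] at h3
      exact h3.le
    have hQ0 : 0 < ν.real Q := by rw [h.5]; positivity
    have hR0 : 0 < ν.real R := by rw [h.6]; positivity
    obtain ⟨P, N, U, hT, hU, hbal, hx⟩ := ih (j + 1) (abs_le.2 ⟨by omega, by omega⟩) h.1 hQ0 F₁ hη₁
    obtain ⟨P', N', U', hT', hU', hbal', hx'⟩ :=
      ih (j - 1) (abs_le.2 ⟨by omega, by omega⟩) h.2 hR0 F₁ hη₁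
    have hTT := hT.union hT' h.disjoint
    rw [h.union_eq] at hTT
    have hdP := h.disjoint.mono hT.subset.1 hT'.subset.1
    have hdN := h.disjoint.mono hT.subset.2.1 hT'.subset.2.1
    have hdU := h.disjoint.mono hT.subset.2.2 hT'.subset.2.2
    have hνP := measureReal_union (μ := ν) hdP hT'.1
    have hνN := measureReal_union (μ := ν) hdN hT'.2
    have hνU := measureReal_union (μ := ν) hdU hT'.3
    have hUA : ν.real (U ∪ U') ≤ ν.real A := measureReal_mono hTT.subset.2.2
    rw [h.5] at hU hbal
    rw [h.6] at hU' hbal'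
    push_cast at hU hU' hbal hbal'
    refine ⟨P ∪ P', N ∪ N', U ∪ U', hTT, ?_, ?_, ?_⟩
    · -- The second moment of the walk grows by `1` with each step on the undecided part.
      push_cast
      rw [hνU] at hUA ⊢
      nlinarith
    · rw [hνP, hνN, hνU]
      rw [abs_le] at hbal hbal' ⊢
      constructor <;> linarith
    · intro x hx1
      obtain ⟨L, hLQ, hL, hL0, E, E', hE, hE', hv, hβ⟩ := hx x hx1
      obtain ⟨L', hLR, hL', hL0', G, G', hG, hG', hv', hβ'⟩ := hx' x hx1
      set w : X := (ν.real A)⁻¹ • (τ Q - τ R) with hw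
      have hnw : ∀ f : X →L[ℝ] X, ‖f (τ Q - τ R)‖ ≤ η₁ * ν.real A → ‖f w‖ ≤ η₁ := fun f hf => by
        rw [hw, map_smul, norm_smul, Real.norm_of_nonneg (by positivity), inv_mul_le_iff₀ hA0,
          mul_comm]
        exact hf
      have hw1 : ‖b.proj F w‖ ≤ η₁ := hnw _ hQR
      have hw2 : ‖w - b.proj F₁ w‖ ≤ η₁ := hnw (ContinuousLinearMap.id ℝ X - b.proj F₁) hF₁
      have hxw : |x (τ Q - τ R)| = ν.real A * |x w| := by
        rw [hw, map_smul, smul_eq_mul, abs_mul, abs_of_nonneg (by positivity : 0 ≤ (ν.real A)⁻¹),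
          mul_inv_cancel_left₀ hA0.ne']
      have hDQ : ∀ L, averageDiff ν τ L A = averageDiff ν τ L Q + w :=
        averageDiff_eq_add_of_isHalving hτ h
      have hDR : ∀ L, averageDiff ν τ L A = averageDiff ν τ L R + -w := fun L => by
        rw [averageDiff_eq_add_of_isHalving hτ h.symm L, hw, ← smul_neg, neg_sub]
      have hsplit : ((M : ℝ) • (τ (P ∪ P') - τ (N ∪ N')) - (j : ℝ) • τ A) =
          ((M : ℝ) • (τ P - τ N) - ((j + 1 : ℤ) : ℝ) • τ Q) +
            ((M : ℝ) • (τ P' - τ N') - ((j - 1 : ℤ) : ℝ) • τ R) + (τ Q - τ R) := by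
        rw [← h.union_eq, hτ.union _ _ h.1 h.2 h.3, hτ.union _ _ hT.1 hT'.1 hdP,
          hτ.union _ _ hT.2 hT'.2 hdN]
        push_cast
        module
      have habs := (abs_add_le (x ((M : ℝ) • (τ P - τ N) - ((j + 1 : ℤ) : ℝ) • τ Q) +
        x ((M : ℝ) • (τ P' - τ N') - ((j - 1 : ℤ) : ℝ) • τ R)) (x (τ Q - τ R))).trans
          (add_le_add_left (abs_add_le _ _) _)
      rw [← map_add, ← map_add, ← hsplit, hxw] at habs
      rw [h.5] at hβ
      rw [h.6] at hβ'
      rw [hνU]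
      rcases le_total (x (b.proj G (averageDiff ν τ L' R) - b.proj G' (averageDiff ν τ L' R)))
        (x (b.proj E (averageDiff ν τ L Q) - b.proj E' (averageDiff ν τ L Q))) with hc | hc
      · obtain ⟨H, H', hH, hH', hF2, hfin⟩ := exists_finset_abs_add_le b hC hF hE hE' hx1 hv hw1 hw2
        rw [← hDQ L] at hF2 hfin
        refine ⟨L, hLQ.trans (h.union_eq ▸ Set.subset_union_left), hL, hL0, H, H', hH, hH', hF2, ?_⟩
        have hmul := mul_le_mul_of_nonneg_left hfin hA0.le
        have hmul' := mul_le_mul_of_nonneg_left hc hA0.le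
        linarith
      · obtain ⟨H, H', hH, hH', hF2, hfin⟩ := exists_finset_abs_add_le b hC hF hG hG' hx1 hv'
          (w := -w) (by rwa [map_neg, norm_neg]) (by rwa [map_neg, ← neg_sub', norm_neg])
        rw [← hDR L'] at hF2 hfin
        refine ⟨L', hLR.trans (h.union_eq ▸ Set.subset_union_right), hL', hL0', H, H', hH, hH',
          hF2, ?_⟩
        rw [map_neg, abs_neg] at hfin
        have hmul := mul_le_mul_of_nonneg_left hfin hA0.le
        have hmul' := mul_le_mul_of_nonneg_left hc hA0.le
        linarith

end Walk

/-! ### Signs with small image -/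

section Main

/-- The sign is the terminal value of the stopped walk with steps `±1 / M`, balanced on the rest
`U`. The image of the walk has norm at most `1 / M` times a bound, independent of `M`, for the
telescoped sums along the paths. Hence one takes `M` large, and then the number `n` of steps so
large that the undecided part is negligible. -/
theorem exists_isHalving_norm_sub_le {α : Type*} {m : MeasurableSpace α} {ν : Measure α}
    [IsFiniteMeasure ν] (hν : IsNonatomic ν) {X β : Type*} [NormedAddCommGroup X]
    [NormedSpace ℝ X] [CompleteSpace X] (b : UnconditionalSchauderBasis β ℝ X) {K : ℝ}
    (hK : 0 ≤ K) {τ : Set α → X} (hτ : IsDominated ν K τ) {A : Set α} (hA : MeasurableSet A)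
    (hA0 : 0 < ν.real A) {ε : ℝ} (hε : 0 < ε) :
    ∃ P N, IsHalving ν A P N ∧ ‖τ P - τ N‖ ≤ ε := by
  obtain ⟨C, hC⟩ := UnconditionalSchauderBasis.exists_norm_proj_le b
  have hC0 : 0 ≤ C := (norm_nonneg _).trans (hC ∅)
  obtain ⟨M, hM⟩ := exists_nat_ge (2 * (ν.real A * (4 * C * K + 1)) / ε)
  have hM0 : 0 < (M : ℝ) := lt_of_lt_of_le (by positivity) hM
  rw [div_le_iff₀ hε] at hM
  obtain ⟨n, hn⟩ := exists_nat_gt (4 * K * (M ^ 2 * ν.real A) / ε)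
  have hn0 : 0 < (n : ℝ) := lt_of_le_of_lt (by positivity) hn
  rw [div_lt_iff₀ hε] at hn
  obtain ⟨P, N, U, hT, hU, hbal, hx⟩ :=
    exists_isTrisection_walk hν b hC hτ M n 0 (by simp) hA hA0 ∅ one_pos
  simp only [Int.cast_natCast, Int.cast_zero, zero_mul, zero_smul, sub_zero, abs_mul,
    abs_of_pos hM0, ne_eq, OfNat.ofNat_ne_zero, not_false_eq_true, zero_pow] at hU hbal hx
  have hbal' := abs_le.1 (le_of_mul_le_mul_left hbal hM0)
  have hPN : M * ‖τ P - τ N‖ ≤ M * K * ν.real U + ν.real A * (4 * C * K + 1) := by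
    obtain ⟨x, hx1, hxz⟩ := exists_dual_vector'' ℝ ((M : ℝ) • (τ P - τ N))
    obtain ⟨L, hLA, hL, hL0, E, E', -, -, -, h⟩ := hx x hx1
    rw [hxz] at h
    simp only [RCLike.ofReal_real_eq_id, id_eq, abs_norm] at h
    rw [norm_smul, Real.norm_of_nonneg hM0.le] at h
    refine h.trans (add_le_add_right (mul_le_mul_of_nonneg_left ?_ hA0.le) _)
    have hD := hτ.norm_averageDiff_le hL hA hL0 hA0
    have hproj : ∀ F, ‖b.proj F (averageDiff ν τ L A)‖ ≤ C * (2 * K) := fun F =>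
      ((b.proj F).le_opNorm _).trans (mul_le_mul (hC F) hD (norm_nonneg _) hC0)
    have h1 := ((Real.le_norm_self _).trans (x.le_opNorm
      (b.proj E (averageDiff ν τ L A) - b.proj E' (averageDiff ν τ L A)))).trans
        (mul_le_of_le_one_left (norm_nonneg _) hx1)
    have h2 := h1.trans (norm_sub_le _ _)
    linarith [hproj E, hproj E']
  -- The undecided part is split so as to balance the measures of the two halves.
  obtain ⟨V, hVU, hV, hνV⟩ := hν.exists_subset_measureReal_eq hT.measurableSet_rest
    (c := (ν.real U + ν.real N - ν.real P) / 2) (by linarith) (by linarith)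
  have hW : MeasurableSet (U \ V) := hT.measurableSet_rest.diff hV
  have hdP : Disjoint P V := hT.disjoint_pos_rest.mono_right hVU
  have hdN : Disjoint N (U \ V) := hT.disjoint_neg_rest.mono_right Set.sdiff_subset
  have hνW : ν.real (U \ V) = ν.real U - ν.real V := measureReal_sdiff hVU hV
  have hνA : ν.real A = ν.real P + ν.real N + ν.real U := by
    rw [← hT.union_eq, measureReal_union _ hT.3, measureReal_union hT.4 hT.2]
    exact Set.disjoint_union_left.2 ⟨hT.5, hT.6⟩
  refine ⟨P ∪ V, N ∪ U \ V, ⟨hT.1.union hV, hT.2.union hW, ?_, ?_, ?_, ?_⟩, ?_⟩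
  · simp only [Set.disjoint_union_left, Set.disjoint_union_right]
    exact ⟨⟨hT.4, (hT.disjoint_neg_rest.mono_right hVU).symm⟩,
      hT.disjoint_pos_rest.mono_right Set.sdiff_subset, Set.disjoint_sdiff_right⟩
  · rw [Set.union_union_union_comm, Set.union_sdiff_cancel hVU, hT.union_eq]
  · rw [measureReal_union hdP hV]; linarith
  · rw [measureReal_union hdN hW]; linarith
  · have hsplit : τ (P ∪ V) - τ (N ∪ U \ V) = (τ P - τ N) + (τ V - τ (U \ V)) := by
      rw [hτ.union _ _ hT.1 hV hdP, hτ.union _ _ hT.2 hW hdN]; abel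
    have h1 : ‖τ V - τ (U \ V)‖ ≤ K * ν.real U := by
      have h2 := norm_sub_le (τ V) (τ (U \ V))
      have h3 := hτ.norm_le _ hV
      have h4 := hτ.norm_le _ hW
      rw [hνW] at h4
      linarith
    have h5 : 4 * (K * ν.real U) ≤ ε := by
      refine le_of_mul_le_mul_left ?_ hn0
      nlinarith
    have h6 : ‖τ P - τ N‖ ≤ K * ν.real U + ε / 2 := by
      refine le_of_mul_le_mul_left ?_ hM0
      linarith
    rw [hsplit]
    linarith [norm_add_le (τ P - τ N) (τ V - τ (U \ V))]

variable {Ω : Type*} [MeasurableSpace Ω] {μ : Measure Ω} [IsFiniteMeasure μ]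
  {X : Type*} [NormedAddCommGroup X] [NormedSpace ℝ X]

/-- The set function `B ↦ T χ_{e(B)}`, with the junk value `0` when `e(B)` is not measurable. -/
noncomputable def imageSetFunction {α : Type*} (T : Lp ℝ 1 μ →L[ℝ] X) (e : α → Ω) (B : Set α) : X :=
  open Classical in
  if h : MeasurableSet (e '' B) then T (indicatorConstLp 1 h (measure_ne_top μ _) (1 : ℝ)) else 0

theorem isDominated_imageSetFunction {α : Type*} {m : MeasurableSpace α} {ν : Measure α}
    (T : Lp ℝ 1 μ →L[ℝ] X) {e : α → Ω} (he : Function.Injective e)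
    (hem : ∀ B, MeasurableSet B → MeasurableSet (e '' B))
    (heν : ∀ B, MeasurableSet B → ν B = μ (e '' B)) :
    IsDominated ν ‖T‖ (imageSetFunction T e) where
  union P N hP hN hd := by
    have hPN := hem _ (hP.union hN)
    rw [imageSetFunction, imageSetFunction, imageSetFunction, dif_pos hPN, dif_pos (hem P hP),
      dif_pos (hem N hN), ← map_add, ← indicatorConstLp_disjoint_union (hem P hP) (hem N hN) _ _
        ((Set.disjoint_image_iff he).2 hd)]
    simp only [Set.image_union]
  norm_le B hB := by
    rw [imageSetFunction, dif_pos (hem B hB)]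
    refine (T.le_opNorm _).trans (mul_le_mul_of_nonneg_left ?_ (norm_nonneg _))
    rw [norm_indicatorConstLp one_ne_zero ENNReal.one_ne_top]
    simp [Measure.real, heν B hB]

/-- Both the restriction of an operator to a sub-`σ`-algebra on a subset and the operator itself are
covered by an injection `e` of a nonatomic measure space that preserves measurability and measure
of sets. -/
theorem exists_isSign_norm_le [CompleteSpace X] {β : Type*} (b : UnconditionalSchauderBasis β ℝ X)
    {α : Type*} {m : MeasurableSpace α} {ν : Measure α} [IsFiniteMeasure ν] (hν : IsNonatomic ν)
    (T : Lp ℝ 1 μ →L[ℝ] X) {e : α → Ω} (he : Function.Injective e)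
    (hem : ∀ B, MeasurableSet B → MeasurableSet (e '' B))
    (heν : ∀ B, MeasurableSet B → ν B = μ (e '' B)) {B : Set α} (hB : MeasurableSet B)
    (hB0 : 0 < ν B) {ε : ℝ} (hε : 0 < ε) :
    ∃ g : α → ℝ, IsSign ν B g ∧ ∃ f : Lp ℝ 1 μ, f =ᵐ[μ] Function.extend e g 0 ∧ ‖T f‖ ≤ ε := by
  classical
  obtain ⟨P, N, h, hle⟩ := exists_isHalving_norm_sub_le hν b (norm_nonneg T)
    (isDominated_imageSetFunction T he hem heν) hB
    (ENNReal.toReal_pos hB0.ne' (measure_ne_top _ _)) hε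
  have hPN : ν P = ν N := (ENNReal.toReal_eq_toReal_iff' (measure_ne_top _ _)
    (measure_ne_top _ _)).1 (h.measureReal_left.trans h.measureReal_right.symm)
  refine ⟨_, ⟨P, N, h.1, h.2, h.3, h.4, hPN, rfl⟩,
    indicatorConstLp 1 (hem P h.1) (measure_ne_top μ _) (1 : ℝ) -
      indicatorConstLp 1 (hem N h.2) (measure_ne_top μ _) (1 : ℝ), ?_, ?_⟩
  · filter_upwards [Lp.coeFn_sub (indicatorConstLp 1 (hem P h.1) (measure_ne_top μ _) (1 : ℝ))
      (indicatorConstLp 1 (hem N h.2) (measure_ne_top μ _) (1 : ℝ)),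
      indicatorConstLp_coeFn (p := 1) (hs := hem P h.1) (hμs := measure_ne_top μ _) (c := (1 : ℝ)),
      indicatorConstLp_coeFn (p := 1) (hs := hem N h.2) (hμs := measure_ne_top μ _) (c := (1 : ℝ))]
      with ω h1 h2 h3
    rw [h1, Pi.sub_apply, h2, h3]
    by_cases hω : ∃ a, e a = ω
    · obtain ⟨a, rfl⟩ := hω
      rw [he.extend_apply]
      simp only [Set.indicator_apply, he.mem_set_image]
    · rw [Function.extend_apply' _ _ _ hω]
      have hout : ∀ S : Set α, ω ∉ e '' S := fun S ⟨a, _, ha⟩ => hω ⟨a, ha⟩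
      rw [Set.indicator_of_notMem (hout P), Set.indicator_of_notMem (hout N)]
      simp
  · rw [map_sub]
    rwa [imageSetFunction, imageSetFunction, dif_pos (hem P h.1), dif_pos (hem N h.2)] at hle

theorem hppNarrow_of_unconditionalSchauderBasis [CompleteSpace X] {β : Type*}
    (b : UnconditionalSchauderBasis β ℝ X) (T : Lp ℝ 1 μ →L[ℝ] X) : HPPNarrow T := by
  intro A hA _ m₁ hm hν B hB hB0 ε hε
  have : IsFiniteMeasure
      (@Measure.comap A Ω Subtype.instMeasurableSpace _ Subtype.val μ) :=
    ⟨by rw [comap_subtype_coe_apply hA]; exact measure_lt_top _ _⟩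
  have : IsFiniteMeasure (subMeasure μ A m₁ hm) := isFiniteMeasure_trim hm
  exact exists_isSign_norm_le b hν T Subtype.val_injective
    (fun S hS => hA.subtype_image (hm S hS))
    (fun S hS => (trim_measurableSet_eq hm hS).trans (comap_subtype_coe_apply hA μ S)) hB hB0 hε

theorem ppNarrow_of_unconditionalSchauderBasis [CompleteSpace X] {β : Type*}
    (b : UnconditionalSchauderBasis β ℝ X) (hμ : IsNonatomic μ) (T : Lp ℝ 1 μ →L[ℝ] X) :
    PPNarrow T := by
  intro A hA hA0 ε hε
  obtain ⟨g, hg, f, hf, hle⟩ := exists_isSign_norm_le b hμ T Function.injective_id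
    (fun B hB => by rwa [Set.image_id]) (fun B _ => by rw [Set.image_id]) hA hA0 hε
  have hext : Function.extend id g 0 = g := funext fun ω =>
    Function.injective_id.extend_apply g 0 ω
  exact ⟨g, hg, f, by rwa [hext] at hf, hle⟩

omit [IsFiniteMeasure μ] in
theorem norm_eq_of_isSign {A : Set Ω} {g : Ω → ℝ} (hg : IsSign μ A g) {f : Lp ℝ 1 μ}
    (hf : f =ᵐ[μ] g) : ‖f‖ = μ.real A := by
  obtain ⟨P, N, hP, hN, hd, rfl, -, rfl⟩ := hg
  have habs : (fun ω => ‖f ω‖) =ᵐ[μ] (P ∪ N).indicator fun _ => (1 : ℝ) := by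
    filter_upwards [hf] with ω hω
    rw [hω]
    by_cases h1 : ω ∈ P
    · have h2 : ω ∉ N := Set.disjoint_left.1 hd h1
      simp [h1, h2]
    · by_cases h2 : ω ∈ N <;> simp [h1, h2]
  rw [L1.norm_eq_integral_norm, integral_congr_ae habs, integral_indicator_const _ (hP.union hN)]
  simp

theorem not_isSignEmbedding_of_ppNarrow (hμ : μ ≠ 0) {T : Lp ℝ 1 μ →L[ℝ] X} (hT : PPNarrow T) :
    ¬ IsSignEmbedding T := by
  rintro ⟨δ, hδ, h⟩
  have hpos : 0 < μ Set.univ := Measure.measure_univ_pos.2 hμ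
  have hpos' : 0 < μ.real Set.univ := ENNReal.toReal_pos hpos.ne' (measure_ne_top _ _)
  obtain ⟨g, hg, f, hf, hle⟩ := hT Set.univ .univ hpos (δ * μ.real Set.univ / 2) (by positivity)
  have := h Set.univ .univ hpos g hg f hf
  rw [norm_eq_of_isSign hg hf] at this
  linarith [mul_pos hδ hpos']

end Main

theorem corollary4p4 {Ω : Type*} [MeasurableSpace Ω] (μ : Measure Ω) [IsProbabilityMeasure μ]
    (hμ : IsNonatomic μ)
    {X : Type*} [NormedAddCommGroup X] [NormedSpace ℝ X] [CompleteSpace X]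
    {β : Type*} [Countable β] (b : UnconditionalSchauderBasis β ℝ X) :
    (∀ T : Lp ℝ 1 μ →L[ℝ] X, HPPNarrow T ∧ PPNarrow T) ∧
      ¬ ∃ T : Lp ℝ 1 μ →L[ℝ] X, IsSignEmbedding T :=
  ⟨fun T => ⟨hppNarrow_of_unconditionalSchauderBasis b T,
    ppNarrow_of_unconditionalSchauderBasis b hμ T⟩, fun ⟨T, hT⟩ =>
    not_isSignEmbedding_of_ppNarrow (IsProbabilityMeasure.ne_zero μ)
      (ppNarrow_of_unconditionalSchauderBasis b hμ T) hT⟩
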